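/- Let $X\subseteq\mathbb{R}^n$ be a compact convex set with non-empty interior, and let $F:X\to\mathbb{R}^n$ be continuous and pseudomonotone plus on $X$, that is, for all $x,y\in X$: $F(x)^T(y-x)\ge 0$ implies $F(y)^T(y-x)\ge 0$, and $F(x)^T(y-x)\ge 0$ together with $F(y)^T(y-x)=0$ implies $F(x)=F(y)$. A solution of $VI(F,X)$ is a point $x^*\in X$ with $F(x^*)^T(y-x^*)\ge 0$ for all $y\in X$. For $S\subseteq X$ put $g_S(x)=\max_{y\in S}F(x)^T(x-y)$. Let $C_1\subseteq C_2\subseteq\cdots$ be polytopes with $\overline{\bigcup_{j\ge1}C_j}=X$, each given by finitely many linear inequalities $C_j=\{x: A_jx\le b_j\}$ that have a strictly feasible point ($A_jx<b_j$ for some $x$). Fix $0\le\eta<1$. An approximate analytic center of a system $Ax\le b$ is a point $x$ whose slack vector $s=b-Ax$ is positive and for which there is a vector $z$ with $A^Tz=0$ and $\|Zs-e\|_2\le\eta$, where $Z=\operatorname{diag}(z)$ and $e$ is the vector of ones. Algorithm 1 is the following procedure. Start with $j=1$. Step 1. Put $k=0$ and let $(A_j^0,b_j^0)=(A_j,b_j)$.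 Step 2. Choose an approximate analytic center $x_j^k$ of the system $A_j^kx\le b_j^k$. Step 3. If $g_X(x_j^k)=0$, stop. Step 4. If $g_{C_j}(x_j^k)<2^{-j}$, increase $j$ by one and go to Step 1. Step 5. Otherwise let $(A_j^{k+1},b_j^{k+1})$ be the system $(A_j^k,b_j^k)$ with the inequality $F(x_j^k)^Tx\le F(x_j^k)^Tx_j^k$ appended, increase $k$ by one and go to Step 2. Theorem 2. Whenever Step 2 is reached, an approximate analytic center exists, so the algorithm can always be carried out. For every choice of the approximate analytic centers, Algorithm 1 either stops after finitely many iterations at a point $x_j^k$ that is a solution of $VI(F,X)$, or it generates an infinite sequence $\{x_j^k\}$ (in order of generation) that has a subsequence converging to a solution $x^*$ of $VI(F,X)$. -/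

import Mathlib

open Filter Topology

noncomputable section

namespace ACCPM

/-- Euclidean `n`-space. -/
abbrev E (n : ℕ) : Type := EuclideanSpace ℝ (Fin n)

/-! ### Variational inequalities -/

/-- The solution set of `VI(F, X)`: points `x ∈ X` with `F(x)ᵀ(y - x) ≥ 0` for all `y ∈ X`. -/
def solutions {n : ℕ} (F : E n → E n) (X : Set (E n)) : Set (E n) :=
  {x | x ∈ X ∧ ∀ y ∈ X, 0 ≤ inner ℝ (F x) (y - x)}

/-- The gap function `g_X(x) = max_{y ∈ X} F(x)ᵀ(x - y)`
(the supremum is attained when `X` is compact and non-empty). -/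
def gap {n : ℕ} (F : E n → E n) (X : Set (E n)) (x : E n) : ℝ :=
  sSup ((fun y => inner ℝ (F x) (x - y)) '' X)

/-- `F` is pseudomonotone on `X`. -/
def Pseudomonotone {n : ℕ} (F : E n → E n) (X : Set (E n)) : Prop :=
  ∀ x ∈ X, ∀ y ∈ X, 0 ≤ inner ℝ (F x) (y - x) → 0 ≤ inner ℝ (F y) (y - x)

/-- `F` is pseudomonotone plus on `X`. -/
def PseudomonotonePlus {n : ℕ} (F : E n → E n) (X : Set (E n)) : Prop :=
  Pseudomonotone F X ∧
    ∀ x ∈ X, ∀ y ∈ X, 0 ≤ inner ℝ (F x) (y - x) → inner ℝ (F y) (y - x) = 0 → F x = F y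

/-! ### Linear inequality systems and approximate analytic centers -/

/-- A finite system of linear inequalities `⟪row i, x⟫ ≤ rhs i`, `i < m`. -/
structure LinSystem (n : ℕ) where
  m : ℕ
  row : Fin m → E n
  rhs : Fin m → ℝ

/-- The slack `s_i = b_i - a_iᵀ x`. -/
def LinSystem.slack {n : ℕ} (P : LinSystem n) (x : E n) (i : Fin P.m) : ℝ :=
  P.rhs i - inner ℝ (P.row i) x

/-- The polyhedron described by the system. -/
def LinSystem.feasible {n : ℕ} (P : LinSystem n) : Set (E n) :=
  {x | ∀ i, 0 ≤ P.slack x i}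

/-- The system enlarged by one more inequality `aᵀ x ≤ β`. -/
def LinSystem.addRow {n : ℕ} (P : LinSystem n) (a : E n) (β : ℝ) : LinSystem n where
  m := P.m + 1
  row := Fin.snoc (α := fun _ => E n) P.row a
  rhs := Fin.snoc (α := fun _ => ℝ) P.rhs β

/-- `x` is an `η`-approximate analytic center of the system: its slacks `s` are positive and there
is a dual vector `z` with `∑ z_i a_i = 0` and `‖Z s - e‖₂ ≤ η`. For `η < 1` such a `z` is
automatically positive; for `η = 0` this is the exact analytic center. -/
def IsApproxCenter {n : ℕ} (η : ℝ) (P : LinSystem n) (x : E n) : Prop :=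
  (∀ i, 0 < P.slack x i) ∧
    ∃ z : EuclideanSpace ℝ (Fin P.m),
      ∑ i, z i • P.row i = 0 ∧
      ‖(WithLp.toLp 2 (fun i => z i * P.slack x i - 1) : EuclideanSpace ℝ (Fin P.m))‖ ≤ η

/-- The polytopes `C_j` (`j ≥ 1`) described by the systems `C j` approximate `X` from inside:
they are full-dimensional, increasing, and the closure of their union is `X`.
(Full-dimensionality is expressed by a strictly feasible point: the polytope has non-empty interior
and its description contains no vacuous inequality `0 ≤ 0`. The sets are bounded, hence polytopes,
as soon as `X` is bounded.) -/
structure InnerApproximation {n : ℕ} (X : Set (E n)) (C : ℕ → LinSystem n) : Prop where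
  fullDim : ∀ j, 1 ≤ j → ∃ x, ∀ i, 0 < (C j).slack x i
  mono : ∀ j, 1 ≤ j → (C j).feasible ⊆ (C (j + 1)).feasible
  closure_eq : closure (⋃ j, ⋃ (_ : 1 ≤ j), (C j).feasible) = X

/-! ### The algorithm -/

/-- A state of the algorithm: the stage `j`, the inner counter `k`,
and the current inequality system describing `C_j^k`. -/
structure State (n : ℕ) where
  stage : ℕ
  iter : ℕ
  sys : LinSystem n

/-- The initial state of stage `j`: `k = 0` and `C_j^0 = C_j`. -/
def State.start {n : ℕ} (C : ℕ → LinSystem n) (j : ℕ) : State n where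
  stage := j
  iter := 0
  sys := C j

/-- The state reached from `σ = (j, k, C_j^k)` when the point `x = x_j^k` has been computed and the
stopping test has failed: if `g_{C_j}(x) < 2⁻ʲ`, stage `j + 1` is started; otherwise the
inequality `F(x)ᵀ y ≤ F(x)ᵀ x` is appended and `k` is increased by one. -/
def State.next {n : ℕ} (F : E n → E n) (C : ℕ → LinSystem n) (σ : State n) (x : E n) : State n :=
  if gap F (C σ.stage).feasible x < 1 / 2 ^ σ.stage then
    State.start C (σ.stage + 1)
  else
    { stage := σ.stage
      iter := σ.iter + 1
      sys := σ.sys.addRow (F x) (inner ℝ (F x) x) }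

/-- The state of the algorithm after `N` iterations in which the points `x 0, …, x (N - 1)` were
computed, in this order. The algorithm begins with stage `1`. -/
def stateAt {n : ℕ} (F : E n → E n) (C : ℕ → LinSystem n) (x : ℕ → E n) : ℕ → State n
  | 0 => State.start C 1
  | N + 1 => (stateAt F C x N).next F C (x N)

/-- The algorithm can reach its iteration `N` by computing `x 0, …, x (N - 1)`: each of these is an
approximate analytic center of the system current at that time, and none of them
passed the stopping test `g_X = 0`. -/
def Reaches {n : ℕ} (F : E n → E n) (X : Set (E n)) (C : ℕ → LinSystem n) (η : ℝ)
    (x : ℕ → E n) (N : ℕ) : Prop :=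
  ∀ i < N, IsApproxCenter η (stateAt F C x i).sys (x i) ∧ gap F X (x i) ≠ 0

/-- `x` records an execution of the algorithm: in each iteration `N` that takes place, i.e. such
that the stopping test failed in all the earlier ones, `x N` is an approximate analytic center of
the current system. (The values of `x` after the algorithm has stopped are irrelevant.) -/
def IsExecution {n : ℕ} (F : E n → E n) (X : Set (E n)) (C : ℕ → LinSystem n) (η : ℝ)
    (x : ℕ → E n) : Prop :=
  ∀ N, (∀ i < N, gap F X (x i) ≠ 0) → IsApproxCenter η (stateAt F C x N).sys (x N)

end ACCPM

end

namespace ACCPM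

/-! ### Intersections of convex sets and the Minty variational inequality -/

/-! An analytic center exists because every system reached has a compact feasible set and a strictly
feasible point: maximize the product of the slacks. A cut preserves strict feasibility, since `F` is
nonzero at a point that failed the stopping test.

For an infinite run the crux is that every stage ends (`exists_gap_lt`). The points ending the
stages then have gaps below `2^(-j)` on polytopes filling `X`, so their cluster points solve the
inequality.

Suppose stage `J` never ends. A Minty solution `y` on `C_J`, obtained from a convex KKM theorem,
survives all cuts. If every cut had depth at least `δ` at a strictly feasible `w`, the logarithmic
potential at `w` would change by at least `log δ` per cut. Its values at the centers eventually
change by at most `log δ - 1`: late cuts nearly repeat many earlier ones, so their slack is tiny in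
the Dikin norm (`eventually_cut_le`), and approximate centers nearly maximize the potential
(`IsApproxCenter.potential_le`). This is absurd, so some cut is shallower than `δ`
(`exists_cut_lt`). Letting `w → y` and `δ → 0` yields a cluster point `xb` with `F(xb)ᵀ(xb - y) =
0`. The plus property gives `F xb = F y`, so `xb` has no positive gap on `C_J`, contradicting the
bound `2^(-J)`. -/

/-- Berge's intersection theorem: if finitely many closed convex sets cover a non-empty compact
convex set `K` and any family with one of them left out has a common point in `K`,
then all of them have a common point in `K`. -/
theorem nonempty_inter_of_covering {V ι : Type*} [NormedAddCommGroup V] [NormedSpace ℝ V]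
    [DecidableEq ι] (M : ι → Set V) (hc : ∀ i, IsClosed (M i)) (hv : ∀ i, Convex ℝ (M i))
    (s : Finset ι) :
    ∀ K : Set V, IsCompact K → Convex ℝ K → K.Nonempty → (K ⊆ ⋃ i ∈ s, M i) →
      (∀ i ∈ s, (K ∩ ⋂ l ∈ s.erase i, M l).Nonempty) → (K ∩ ⋂ l ∈ s, M l).Nonempty := by
  induction s using Finset.induction_on with
  | empty => intro K _ _ hne _ _; simpa using hne
  | insert a s ha ih =>
    intro K hK hKv hne hcov hint
    rcases s.eq_empty_or_nonempty with rfl | ⟨i₀, hi₀⟩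
    · obtain ⟨x, hx⟩ := hne
      have := hcov hx
      exact ⟨x, hx, by simpa using this⟩
    by_contra hcon
    have hAc : IsClosed (⋂ l ∈ s, M l) := isClosed_biInter fun i _ => hc i
    have hAne : (K ∩ ⋂ l ∈ s, M l).Nonempty := by
      simpa [Finset.erase_insert ha] using hint a (Finset.mem_insert_self a s)
    have hdisj : Disjoint (K ∩ ⋂ l ∈ s, M l) (K ∩ M a) := by
      rw [Set.disjoint_left]
      rintro x ⟨hxK, hx⟩ ⟨_, hxa⟩
      refine hcon ⟨x, hxK, ?_⟩
      simp only [Set.mem_iInter, Finset.mem_insert] at hx ⊢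
      rintro l (rfl | hl)
      · exact hxa
      · exact hx l hl
    -- The slice `f = u` of `K` misses `M a`, so the sets indexed by `s` cover it. Induction on the
    -- slice gives them a common point with `f = u`, whereas all their common points in `K` have `f
    -- < u`.
    obtain ⟨f, u, v, hfA, huv, hfB⟩ := geometric_hahn_banach_compact_closed
      (hKv.inter (convex_iInter₂ fun i _ => hv i)) (hK.inter_right hAc) (hKv.inter (hv a))
      (hK.isClosed.inter (hc a)) hdisj
    have hK' : IsCompact (K ∩ {x | f x = u}) :=
      hK.inter_right (isClosed_eq f.continuous continuous_const)
    have hK'v : Convex ℝ (K ∩ {x | f x = u}) :=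
      hKv.inter (convex_hyperplane f.toLinearMap.isLinear u)
    have hint' : ∀ i ∈ s, ((K ∩ {x | f x = u}) ∩ ⋂ l ∈ s.erase i, M l).Nonempty := by
      intro i hi
      obtain ⟨p, hp⟩ := hAne
      obtain ⟨q, hqK, hq⟩ := hint i (Finset.mem_insert_of_mem hi)
      have hai : a ≠ i := fun h => ha (h ▸ hi)
      have hqa : q ∈ M a := by
        simp only [Set.mem_iInter] at hq
        exact hq a (Finset.mem_erase.2 ⟨hai, Finset.mem_insert_self a s⟩)
      have hW : Convex ℝ (K ∩ ⋂ l ∈ s.erase i, M l) :=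
        hKv.inter (convex_iInter₂ fun i _ => hv i)
      have hpW : p ∈ K ∩ ⋂ l ∈ s.erase i, M l := by
        refine ⟨hp.1, ?_⟩
        have := hp.2
        simp only [Set.mem_iInter] at this ⊢
        exact fun l hl => this l (Finset.mem_of_mem_erase hl)
      have hqW : q ∈ K ∩ ⋂ l ∈ s.erase i, M l := by
        refine ⟨hqK, ?_⟩
        simp only [Set.mem_iInter] at hq ⊢
        intro l hl
        refine hq l (Finset.mem_erase.2 ⟨(Finset.mem_erase.1 hl).1, ?_⟩)
        exact Finset.mem_insert_of_mem (Finset.mem_of_mem_erase hl)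
      -- `p` and `q` lie on opposite sides of the hyperplane, so a convex set containing both meets
      -- it.
      obtain ⟨y, hy, hfy⟩ := hW.isPreconnected.intermediate_value hpW hqW
        f.continuous.continuousOn ⟨(hfA p hp).le, (huv.trans (hfB q ⟨hqK, hqa⟩)).le⟩
      exact ⟨y, ⟨hy.1, hfy⟩, hy.2⟩
    have hcov' : (K ∩ {x | f x = u}) ⊆ ⋃ i ∈ s, M i := by
      rintro x ⟨hx, hfx⟩
      have h := hcov hx
      simp only [Set.mem_iUnion, Finset.mem_insert, exists_prop] at h ⊢
      obtain ⟨i, rfl | hi, hxi⟩ := h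
      · exact absurd (huv.trans (hfB x ⟨hx, hxi⟩)) (not_lt.2 (le_of_eq hfx))
      · exact ⟨i, hi, hxi⟩
    obtain ⟨x, ⟨hxK, hfx⟩, hx⟩ := ih _ hK' hK'v
      ((hint' i₀ hi₀).mono Set.inter_subset_left) hcov' hint'
    exact absurd (hfA x ⟨hxK, hx⟩) (not_lt.2 (le_of_eq hfx.symm))

/-- The Knaster-Kuratowski-Mazurkiewicz theorem for convex sets. -/
theorem nonempty_inter_of_convexHull_subset {V : Type*} [NormedAddCommGroup V] [NormedSpace ℝ V]
    [DecidableEq V] (M : V → Set V) (hc : ∀ i, IsClosed (M i)) (hv : ∀ i, Convex ℝ (M i))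
    (s : Finset V) (hs : s.Nonempty)
    (hcov : ∀ t ⊆ s, convexHull ℝ (t : Set V) ⊆ ⋃ i ∈ t, M i) :
    (convexHull ℝ (s : Set V) ∩ ⋂ l ∈ s, M l).Nonempty := by
  induction s using Finset.strongInduction with
  | H s ih =>
    have hne : (convexHull ℝ (s : Set V)).Nonempty :=
      convexHull_nonempty_iff.2 (Finset.coe_nonempty.2 hs)
    refine nonempty_inter_of_covering M hc hv s _ (s.finite_toSet.isCompact_convexHull ℝ)
      (convex_convexHull ℝ _) hne (hcov s subset_rfl) fun i hi => ?_
    rcases (s.erase i).eq_empty_or_nonempty with h | h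
    · rw [h]; simpa using hne
    · refine (ih _ (Finset.erase_ssubset hi) h
        fun t ht => hcov t (ht.trans (Finset.erase_subset i s))).mono ?_
      exact Set.inter_subset_inter_left _
        (convexHull_mono (Finset.coe_subset.2 (Finset.erase_subset i s)))

/-- A pseudomonotone map on a compact convex set has a solution of the Minty inequality. -/
theorem Pseudomonotone.exists_minty {n : ℕ} {F : E n → E n} {K : Set (E n)}
    (hF : Pseudomonotone F K) (hK : IsCompact K) (hKv : Convex ℝ K) (hne : K.Nonempty) :
    ∃ y ∈ K, ∀ x ∈ K, 0 ≤ inner ℝ (F x) (x - y) := by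
  classical
  let M : E n → Set (E n) := fun y => {x | 0 ≤ inner ℝ (F y) (y - x)}
  have hc : ∀ y, IsClosed (M y) := fun y =>
    isClosed_le continuous_const (by fun_prop)
  have hv : ∀ y, Convex ℝ (M y) := by
    intro y
    have : M y = {x | inner ℝ (F y) x ≤ inner ℝ (F y) y} := by
      ext x; simp [M, inner_sub_right]
    rw [this]
    exact convex_halfSpace_le (innerSL ℝ (F y)).toLinearMap.isLinear _
  have key : (K ∩ ⋂ y : K, M y).Nonempty := by
    refine hK.inter_iInter_nonempty (fun y : K => M y) (fun y => hc y) fun u => ?_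
    rcases u.eq_empty_or_nonempty with rfl | hu
    · simpa using hne
    have himg : ((u.image Subtype.val : Finset (E n)) : Set (E n)) ⊆ K := by
      intro y hy
      simp only [Finset.coe_image, Set.mem_image] at hy
      obtain ⟨z, _, rfl⟩ := hy
      exact z.2
    obtain ⟨x, hx1, hx2⟩ := nonempty_inter_of_convexHull_subset M hc hv (u.image Subtype.val)
      (hu.image _) (by
        intro t ht x hx
        have htK : (t : Set (E n)) ⊆ K := (Finset.coe_subset.2 ht).trans himg
        have hxK : x ∈ K := convexHull_min htK hKv hx
        by_contra hcon
        simp only [Set.mem_iUnion, exists_prop, not_exists, not_and] at hcon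
        -- By pseudomonotonicity, an `x` outside every `M y`, `y ∈ t`, would satisfy `F(x)ᵀy <
        -- F(x)ᵀx` on `t`, hence on its convex hull, hence at `y = x`.
        have hlt : (t : Set (E n)) ⊆ {y | inner ℝ (F x) y < inner ℝ (F x) x} := by
          intro y hy
          by_contra h
          refine hcon y hy (hF x hxK y (htK hy) ?_)
          rw [inner_sub_right]
          simpa using h
        have := convexHull_min hlt
          (convex_halfSpace_lt (innerSL ℝ (F x)).toLinearMap.isLinear _) hx
        simp at this)
    refine ⟨x, convexHull_min himg hKv hx1, ?_⟩
    simp only [Set.mem_iInter, Finset.mem_image] at hx2 ⊢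
    exact fun i hi => hx2 i ⟨i, hi, rfl⟩
  obtain ⟨y, hyK, hy⟩ := key
  simp only [Set.mem_iInter] at hy
  exact ⟨y, hyK, fun x hx => hy ⟨x, hx⟩⟩

/-- Minty's lemma: a solution of the Minty inequality is a solution of `VI(F, K)`. -/
theorem mem_solutions_of_minty {n : ℕ} {F : E n → E n} {K : Set (E n)} (hFc : ContinuousOn F K)
    (hKv : Convex ℝ K) {y : E n} (hy : y ∈ K) (h : ∀ x ∈ K, 0 ≤ inner ℝ (F x) (x - y)) :
    y ∈ solutions F K := by
  refine ⟨hy, fun x hx => ?_⟩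
  have hmem : ∀ t ∈ Set.Ioo (0 : ℝ) 1, y + t • (x - y) ∈ K := fun t ht =>
    hKv.add_smul_sub_mem hy hx ⟨ht.1.le, ht.2.le⟩
  have hlim : Tendsto (fun t : ℝ => y + t • (x - y)) (𝓝[>] 0) (𝓝[K] y) := by
    refine tendsto_nhdsWithin_iff.2 ⟨?_, ?_⟩
    · have : Tendsto (fun t : ℝ => y + t • (x - y)) (𝓝 0) (𝓝 (y + (0 : ℝ) • (x - y))) :=
        Continuous.tendsto (by fun_prop) 0
      simpa using this.mono_left nhdsWithin_le_nhds
    · filter_upwards [Ioo_mem_nhdsGT (zero_lt_one (α := ℝ))] with t ht using hmem t ht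
  have hFlim : Tendsto (fun t : ℝ => inner ℝ (F (y + t • (x - y))) (x - y)) (𝓝[>] 0)
      (𝓝 (inner ℝ (F y) (x - y))) :=
    Tendsto.inner ((hFc y hy).tendsto.comp hlim) tendsto_const_nhds
  refine ge_of_tendsto hFlim ?_
  filter_upwards [Ioo_mem_nhdsGT (zero_lt_one (α := ℝ))] with t ht
  have := h _ (hmem t ht)
  rw [add_sub_cancel_left, inner_smul_right] at this
  exact nonneg_of_mul_nonneg_right this ht.1

end ACCPM

namespace ACCPM

/-! ### Linear systems -/

theorem LinSystem.slack_sub {n : ℕ} (P : LinSystem n) (x w : E n) (i : Fin P.m) :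
    P.slack w i - P.slack x i = inner ℝ (P.row i) (x - w) := by
  simp only [LinSystem.slack, inner_sub_right]; ring

theorem LinSystem.slack_add_smul {n : ℕ} (P : LinSystem n) (x w : E n) (t : ℝ) (i : Fin P.m) :
    P.slack (x + t • (w - x)) i = P.slack x i + t * (P.slack w i - P.slack x i) := by
  simp only [LinSystem.slack, inner_add_right, inner_smul_right, inner_sub_right]; ring

@[fun_prop]
theorem LinSystem.continuous_slack {n : ℕ} (P : LinSystem n) (i : Fin P.m) :
    Continuous fun x => P.slack x i := by
  unfold LinSystem.slack; fun_prop

theorem LinSystem.isClosed_feasible {n : ℕ} (P : LinSystem n) : IsClosed P.feasible := by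
  have : P.feasible = ⋂ i, {x | 0 ≤ P.slack x i} := by ext; simp [LinSystem.feasible]
  rw [this]
  exact isClosed_iInter fun i => isClosed_le continuous_const (P.continuous_slack i)

theorem LinSystem.convex_feasible {n : ℕ} (P : LinSystem n) : Convex ℝ P.feasible := by
  have : P.feasible = ⋂ i, {x | inner ℝ (P.row i) x ≤ P.rhs i} := by
    ext; simp [LinSystem.feasible, LinSystem.slack]
  rw [this]
  exact convex_iInter fun i => convex_halfSpace_le (innerSL ℝ (P.row i)).toLinearMap.isLinear _

theorem LinSystem.sum_addRow {n : ℕ} (P : LinSystem n) (a : E n) (β : ℝ) (g : E n → ℝ → ℝ) :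
    ∑ i, g ((P.addRow a β).row i) ((P.addRow a β).rhs i)
      = ∑ i, g (P.row i) (P.rhs i) + g a β := by
  change ∑ i : Fin (P.m + 1), _ = _
  rw [Fin.sum_univ_castSucc]
  simp [LinSystem.addRow]

theorem LinSystem.forall_slack_addRow {n : ℕ} (P : LinSystem n) (a : E n) (β : ℝ) (x : E n)
    (p : ℝ → Prop) :
    (∀ i, p ((P.addRow a β).slack x i)) ↔ (∀ i, p (P.slack x i)) ∧ p (β - inner ℝ a x) := by
  change (∀ i : Fin (P.m + 1), _) ↔ _
  rw [Fin.forall_fin_succ']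
  simp [LinSystem.addRow, LinSystem.slack]

theorem LinSystem.mem_feasible_addRow {n : ℕ} (P : LinSystem n) (a : E n) (β : ℝ) (x : E n) :
    x ∈ (P.addRow a β).feasible ↔ x ∈ P.feasible ∧ inner ℝ a x ≤ β := by
  have := P.forall_slack_addRow a β x (0 ≤ ·)
  simpa only [LinSystem.feasible, Set.mem_ofPred_eq, sub_nonneg] using this

theorem IsApproxCenter.mem_feasible {n : ℕ} {η : ℝ} {P : LinSystem n} {x : E n}
    (h : IsApproxCenter η P x) : x ∈ P.feasible := fun i => (h.1 i).le

/-- A bounded system with a strictly feasible point has an analytic center. -/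
theorem exists_isApproxCenter {n : ℕ} {η : ℝ} (hη : 0 ≤ η) (P : LinSystem n)
    (hP : IsCompact P.feasible) (hs : ∃ x, ∀ i, 0 < P.slack x i) :
    ∃ x, IsApproxCenter η P x := by
  obtain ⟨x₀, hx₀⟩ := hs
  -- The product, unlike the sum of logarithms, is continuous up to the boundary, where it vanishes.
  obtain ⟨p, hpf, hp⟩ := hP.exists_isMaxOn ⟨x₀, fun i => (hx₀ i).le⟩
    (f := fun x => ∏ i, P.slack x i)
    (continuous_finsetProd _ fun i _ => P.continuous_slack i).continuousOn
  have hprod : 0 < ∏ i, P.slack p i :=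
    (Finset.prod_pos fun i _ => hx₀ i).trans_le (hp (fun i => (hx₀ i).le : x₀ ∈ P.feasible))
  have hpos : ∀ i, 0 < P.slack p i := fun i =>
    lt_of_le_of_ne (hpf i) fun h => hprod.ne' (Finset.prod_eq_zero (Finset.mem_univ i) h.symm)
  -- The gradient of the potential at `p` is `-v`. Its derivative along `v` itself is `-‖v‖²`, so
  -- maximality forces `v = 0`, and `z = 1/s` is an exact dual vector.
  set v : E n := ∑ i, (P.slack p i)⁻¹ • P.row i with hv
  have hsl : ∀ (t : ℝ) i, P.slack (p + t • v) i = P.slack p i - t * inner ℝ (P.row i) v := by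
    intro t i
    simp only [LinSystem.slack, inner_add_right, inner_smul_right]; ring
  have hev : ∀ᶠ t : ℝ in 𝓝 0, ∀ i, 0 < P.slack (p + t • v) i := by
    refine eventually_all.2 fun i => ?_
    have hc : Continuous fun t : ℝ => P.slack (p + t • v) i := by fun_prop
    exact hc.continuousAt.eventually (eventually_gt_nhds (by simpa using hpos i))
  have hmax : IsLocalMax (fun t : ℝ => ∑ i, Real.log (P.slack p i - t * inner ℝ (P.row i) v))
      0 := by
    filter_upwards [hev] with t ht
    simp only [← hsl, zero_smul, add_zero]
    rw [← Real.log_prod fun i _ => (ht i).ne', ← Real.log_prod fun i _ => (hpos i).ne']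
    exact Real.log_le_log (Finset.prod_pos fun i _ => ht i) (hp fun i => (ht i).le)
  have hder : HasDerivAt
      (fun t : ℝ => ∑ i, Real.log (P.slack p i - t * inner ℝ (P.row i) v))
      (∑ i, (-inner ℝ (P.row i) v) / P.slack p i) 0 := by
    refine HasDerivAt.fun_sum fun i _ => ?_
    have h1 : HasDerivAt (fun t : ℝ => P.slack p i - t * inner ℝ (P.row i) v)
        (-inner ℝ (P.row i) v) 0 := by
      simpa using ((hasDerivAt_id (0 : ℝ)).mul_const (inner ℝ (P.row i) v)).const_sub (P.slack p i)
    have h2 := h1.log (by simpa using (hpos i).ne')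
    simpa using h2
  have hzero := hmax.hasDerivAt_eq_zero hder
  have hvv : inner ℝ v v = 0 := by
    conv_lhs => rw [hv]
    rw [sum_inner]
    simp only [inner_smul_left, RCLike.conj_to_real]
    have : ∑ i, (-inner ℝ (P.row i) v) / P.slack p i
        = -∑ i, (P.slack p i)⁻¹ * inner ℝ (P.row i) v := by
      rw [← Finset.sum_neg_distrib]
      exact Finset.sum_congr rfl fun i _ => by ring
    rw [← hv]
    linarith [this, hzero]
  refine ⟨p, hpos, WithLp.toLp 2 fun i => (P.slack p i)⁻¹, inner_self_eq_zero.1 hvv, ?_⟩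
  have : (fun i => (P.slack p i)⁻¹ * P.slack p i - 1) = 0 := by
    funext i; simp [(hpos i).ne']
  simpa [this] using hη

/-! ### The potential at approximate analytic centers -/

/-- For `t ≥ 0` put `q = √(1 + t)`; then `log q ≤ sinh (log q)` gives `log (1 + t) ≤ q - 1/q`. For
`t ≤ 0` the bound `t²/2` is enough. The denominator grows like `ρ`, with coefficient one, which is
what admits every `η < 1`; `2(1 + ρ)` would only serve `η < 1/2`. -/
theorem sq_div_le_sub_log {t ρ : ℝ} (ht : -1 < t) (htρ : |t| ≤ ρ) :
    t ^ 2 / (1 + ρ + √(1 + ρ)) ≤ t - Real.log (1 + t) := by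
  have hρ : 0 ≤ ρ := (abs_nonneg t).trans htρ
  have h1 : 1 ≤ √(1 + ρ) := Real.one_le_sqrt.2 (by linarith)
  rcases le_total 0 t with h0 | h0
  · have hq : 0 < √(1 + t) := Real.sqrt_pos.2 (by linarith)
    have hqq : √(1 + t) * √(1 + t) = 1 + t := Real.mul_self_sqrt (by linarith)
    have hq1 : 1 ≤ √(1 + t) := Real.one_le_sqrt.2 (by linarith)
    have hlog : Real.log (1 + t) ≤ √(1 + t) - (√(1 + t))⁻¹ := by
      have h := Real.self_le_sinh_iff.2 (Real.log_nonneg hq1)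
      rw [Real.sinh_eq, Real.exp_neg, Real.exp_log hq] at h
      have h2 : Real.log (1 + t) = 2 * Real.log √(1 + t) := by
        rw [Real.log_sqrt (by linarith)]; ring
      rw [h2]; linarith
    have hmono : √(1 + t) ≤ √(1 + ρ) := Real.sqrt_le_sqrt (by linarith [le_abs_self t])
    have hle : t ≤ ρ := (le_abs_self t).trans htρ
    calc t ^ 2 / (1 + ρ + √(1 + ρ)) ≤ t ^ 2 / (1 + t + √(1 + t)) := by gcongr
      _ = t - (√(1 + t) - (√(1 + t))⁻¹) := by
        set q := √(1 + t)
        have : t = q * q - 1 := by linarith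
        have hq2 : q + 1 ≠ 0 := by positivity
        rw [this]
        have : 1 + (q * q - 1) + q = q * (q + 1) := by ring
        rw [this]
        field_simp
        ring
      _ ≤ _ := by linarith
  · have hden : 2 ≤ 1 + ρ + √(1 + ρ) := by linarith
    have hlog : Real.log (1 + t) ≤ t - t ^ 2 / 2 := by
      have h := Real.hasSum_pow_div_log_of_abs_lt_one (x := -t)
        (by rw [abs_neg, abs_lt]; constructor <;> linarith)
      have h2 := sum_le_hasSum (Finset.range 2) (fun i _ => by
        have : 0 ≤ -t := by linarith
        positivity) h
      simp [Finset.sum_range_succ] at h2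
      rw [add_comm] at h2
      norm_num at h2
      linarith
    calc t ^ 2 / (1 + ρ + √(1 + ρ)) ≤ t ^ 2 / 2 := by gcongr
      _ ≤ _ := by linarith

/-- Here `r` stands for the slack ratios and `p` for the products `z_i s_i`. Orthogonality turns `∑
(r i - 1)` into `∑ (1 - p i) * (r i - 1)`, at most `η * ρ` by Cauchy-Schwarz; the concavity of the
logarithm costs at least `ρ - √ρ`. -/
theorem sum_log_le {ι : Type*} [Fintype ι] {η : ℝ} (hη : 0 ≤ η) (r p : ι → ℝ)
    (hr : ∀ i, 0 < r i) (h0 : ∑ i, p i * (r i - 1) = 0) (hp : ∑ i, (p i - 1) ^ 2 ≤ η ^ 2) {ρ : ℝ}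
    (hρ : 0 ≤ ρ) (hρr : ρ ^ 2 = ∑ i, (r i - 1) ^ 2) :
    ∑ i, Real.log (r i) ≤ √ρ - (1 - η) * ρ := by
  have hs1 : 0 < √(1 + ρ) := Real.sqrt_pos.2 (by linarith)
  have hss : √(1 + ρ) * √(1 + ρ) = 1 + ρ := Real.mul_self_sqrt (by linarith)
  have habs : ∀ i, |r i - 1| ≤ ρ := fun i => by
    rw [← abs_of_nonneg hρ, ← sq_le_sq, hρr]
    exact Finset.single_le_sum (f := fun i => (r i - 1) ^ 2) (fun i _ => sq_nonneg _)
      (Finset.mem_univ i)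
  have h1 : ρ ^ 2 / (1 + ρ + √(1 + ρ)) ≤ ∑ i, ((r i - 1) - Real.log (r i)) := by
    rw [hρr, Finset.sum_div]
    refine Finset.sum_le_sum fun i _ => ?_
    have := sq_div_le_sub_log (t := r i - 1) (by linarith [hr i]) (habs i)
    simpa using this
  have h2 : ∑ i, (1 - p i) * (r i - 1) ≤ η * ρ := by
    refine abs_le_of_sq_le_sq' ?_ (by positivity) |>.2
    calc (∑ i, (1 - p i) * (r i - 1)) ^ 2
        ≤ (∑ i, (1 - p i) ^ 2) * ∑ i, (r i - 1) ^ 2 := Finset.sum_mul_sq_le_sq_mul_sq _ _ _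
      _ ≤ η ^ 2 * ρ ^ 2 := by
        rw [← hρr]
        gcongr
        refine le_trans (le_of_eq (Finset.sum_congr rfl fun i _ => by ring)) hp
      _ = (η * ρ) ^ 2 := by ring
  have h3 : ∑ i, (1 - p i) * (r i - 1) = ∑ i, (r i - 1) := by
    rw [← sub_zero (∑ i, (r i - 1)), ← h0, ← Finset.sum_sub_distrib]
    exact Finset.sum_congr rfl fun i _ => by ring
  rw [Finset.sum_sub_distrib] at h1
  have h4 : ρ - √ρ ≤ ρ ^ 2 / (1 + ρ + √(1 + ρ)) := by
    have e : ρ ^ 2 / (1 + ρ + √(1 + ρ)) = ρ - ρ / √(1 + ρ) := by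
      set q := √(1 + ρ)
      have hρq : ρ = q * q - 1 := by linarith
      have hq2 : q + 1 ≠ 0 := by positivity
      have : 1 + ρ + q = q * (q + 1) := by rw [hρq]; ring
      rw [this, hρq]
      field_simp
      ring
    rw [e]
    have : ρ / √(1 + ρ) ≤ √ρ := by
      rw [div_le_iff₀ hs1]
      calc ρ = √ρ * √ρ := (Real.mul_self_sqrt hρ).symm
        _ ≤ √ρ * √(1 + ρ) := by gcongr; linarith
    linarith
  linarith

/-- The logarithmic potential of the slacks. -/
noncomputable def potential {n : ℕ} (P : LinSystem n) (x : E n) : ℝ :=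
  ∑ i, Real.log (P.slack x i)

/-- The distance from `x` to `w` in the norm of the Dikin ellipsoid at `x`. -/
noncomputable def localDist {n : ℕ} (P : LinSystem n) (x w : E n) : ℝ :=
  √(∑ i, ((P.slack w i - P.slack x i) / P.slack x i) ^ 2)

theorem localDist_sq {n : ℕ} (P : LinSystem n) (x w : E n) :
    localDist P x w ^ 2 = ∑ i, ((P.slack w i - P.slack x i) / P.slack x i) ^ 2 :=
  Real.sq_sqrt (Finset.sum_nonneg fun _ _ => sq_nonneg _)

theorem localDist_nonneg {n : ℕ} (P : LinSystem n) (x w : E n) : 0 ≤ localDist P x w :=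
  Real.sqrt_nonneg _

theorem IsApproxCenter.potential_le {n : ℕ} {η : ℝ} (hη : 0 ≤ η) {P : LinSystem n} {x w : E n}
    (hx : IsApproxCenter η P x) (hw : ∀ i, 0 < P.slack w i) :
    potential P w ≤ potential P x + (√(localDist P x w) - (1 - η) * localDist P x w) := by
  obtain ⟨hpos, z, hz0, hz⟩ := hx
  have h := sum_log_le hη (fun i => P.slack w i / P.slack x i) (fun i => z i * P.slack x i)
    (fun i => div_pos (hw i) (hpos i)) ?_ ?_ (localDist_nonneg P x w) ?_
  · have e : ∑ i, Real.log (P.slack w i / P.slack x i) = potential P w - potential P x := by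
      rw [potential, potential, ← Finset.sum_sub_distrib]
      exact Finset.sum_congr rfl fun i _ => Real.log_div (hw i).ne' (hpos i).ne'
    linarith
  · calc ∑ i, z i * P.slack x i * (P.slack w i / P.slack x i - 1)
        = ∑ i, inner ℝ (z i • P.row i) (x - w) := by
          refine Finset.sum_congr rfl fun i _ => ?_
          rw [real_inner_smul_left, ← P.slack_sub]
          have := (hpos i).ne'
          field_simp
      _ = 0 := by rw [← sum_inner, hz0, inner_zero_left]
  · rw [EuclideanSpace.norm_eq] at hz
    have := (Real.sqrt_le_left hη).1 hz
    simpa [Real.norm_eq_abs, sq_abs] using this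
  · rw [localDist_sq]
    refine Finset.sum_congr rfl fun i _ => ?_
    rw [sub_div, div_self (hpos i).ne']

/-- The Dikin ellipsoid is contained in the feasible set, so its norm dominates the Euclidean one
if the feasible set is bounded. -/
theorem norm_sub_le_mul_localDist {n : ℕ} {P : LinSystem n} {D : ℝ} (hD : 0 < D)
    (hP : ∀ y ∈ P.feasible, ∀ z ∈ P.feasible, ‖y - z‖ ≤ D) {x w : E n}
    (hx : ∀ i, 0 < P.slack x i) : ‖w - x‖ ≤ D * localDist P x w := by
  rw [← div_le_iff₀' hD]
  -- A radius strictly above the local distance is positive, so it can be inverted even when that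
  -- distance is zero.
  refine le_of_forall_gt_imp_ge_of_dense fun ρ hρ => ?_
  have hρ0 : 0 < ρ := (localDist_nonneg P x w).trans_lt hρ
  rw [div_le_iff₀' hD]
  have hmem : x + ρ⁻¹ • (w - x) ∈ P.feasible := by
    intro i
    rw [P.slack_add_smul]
    have h1 : |(P.slack w i - P.slack x i) / P.slack x i| ≤ ρ := by
      refine (abs_le_of_sq_le_sq ?_ (localDist_nonneg P x w)).trans hρ.le
      rw [localDist_sq]
      exact Finset.single_le_sum (f := fun i => ((P.slack w i - P.slack x i) / P.slack x i) ^ 2)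
        (fun i _ => sq_nonneg _) (Finset.mem_univ i)
    have h2 := (abs_le.1 h1).1
    rw [le_div_iff₀ (hx i)] at h2
    have h3 : ρ⁻¹ * (-ρ * P.slack x i) ≤ ρ⁻¹ * (P.slack w i - P.slack x i) := by gcongr
    have h4 : ρ⁻¹ * (-ρ * P.slack x i) = -P.slack x i := by field_simp
    linarith
  have := hP _ hmem x fun i => (hx i).le
  rw [add_sub_cancel_left, norm_smul, Real.norm_of_nonneg (by positivity)] at this
  rwa [inv_mul_le_iff₀ hρ0, mul_comm] at this

end ACCPM

namespace ACCPM

/-! ### Infinite sequences of central cuts -/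

/-- In a bounded sequence, each late term has many predecessors close to it. -/
theorem eventually_exists_close {n : ℕ} {M : ℝ} (a : ℕ → E n) (ha : ∀ k, ‖a k‖ ≤ M) (N : ℕ)
    {θ : ℝ} (hθ : 0 < θ) :
    ∀ᶠ k in atTop, ∃ I ⊆ Finset.range k, I.card = N ∧ ∀ i ∈ I, ‖a k - a i‖ ≤ θ := by
  classical
  obtain ⟨t, htf, ht⟩ := Metric.totallyBounded_iff.1
    (isCompact_closedBall (0 : E n) M).totallyBounded (θ / 2) (half_pos hθ)
  have hc : ∀ k, ∃ c ∈ t, dist (a k) c < θ / 2 := fun k => by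
    have := ht (mem_closedBall_zero_iff.2 (ha k))
    simpa using this
  have hcol : ∀ᶠ k in atTop, ∀ c ∈ t, dist (a k) c < θ / 2 →
      ∃ I ⊆ Finset.range k, I.card = N ∧ ∀ i ∈ I, dist (a i) c < θ / 2 := by
    -- A ball visited infinitely often eventually supplies `N` predecessors; one visited finitely
    -- often is eventually never visited again.
    refine (eventually_all_finite htf).2 fun c _ => ?_
    by_cases hinf : {k | dist (a k) c < θ / 2}.Infinite
    · obtain ⟨I, hI, hIc⟩ := hinf.exists_subset_card_eq N
      obtain ⟨m, hm⟩ := I.exists_nat_subset_range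
      filter_upwards [eventually_ge_atTop m] with k hk _
      exact ⟨I, hm.trans (Finset.range_mono hk), hIc, fun i hi => hI hi⟩
    · have := (Set.not_infinite.1 hinf).eventually_cofinite_notMem
      rw [Nat.cofinite_eq_atTop] at this
      filter_upwards [this] with k hk h
      exact absurd h hk
  filter_upwards [hcol] with k hk
  obtain ⟨c, hct, hkc⟩ := hc k
  obtain ⟨I, hI, hIN, hIc⟩ := hk c hct hkc
  refine ⟨I, hI, hIN, fun i hi => ?_⟩
  rw [← dist_eq_norm]
  linarith [dist_triangle_right (a k) (a i) c, hIc i hi]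

section Cuts

variable {n : ℕ} {P : ℕ → LinSystem n} {a x : ℕ → E n}

/-- With `g` arbitrary, one induction covers any sum over rows, such as the squared Dikin norm. -/
theorem sum_cuts (hP : ∀ k, P (k + 1) = (P k).addRow (a k) (inner ℝ (a k) (x k)))
    (g : E n → ℝ → ℝ) (k : ℕ) :
    ∑ i, g ((P k).row i) ((P k).rhs i)
      = ∑ i, g ((P 0).row i) ((P 0).rhs i)
        + ∑ j ∈ Finset.range k, g (a j) (inner ℝ (a j) (x j)) := by
  induction k with
  | zero => simp
  | succ k ih => rw [hP k, LinSystem.sum_addRow, ih, Finset.sum_range_succ, add_assoc]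

theorem potential_succ (hP : ∀ k, P (k + 1) = (P k).addRow (a k) (inner ℝ (a k) (x k)))
    (k : ℕ) (w : E n) :
    potential (P (k + 1)) w = potential (P k) w + Real.log (inner ℝ (a k) (x k - w)) := by
  rw [hP k, inner_sub_right]
  exact (P k).sum_addRow _ _ fun r β => Real.log (β - inner ℝ r w)

/-- Each cut is a row of `P k` with slack `⟪a j, x j - x k⟫` at `x k`; the terms of the initial rows
are dropped. -/
theorem sum_cuts_le_localDist_sq
    (hP : ∀ k, P (k + 1) = (P k).addRow (a k) (inner ℝ (a k) (x k))) (k : ℕ) (w : E n) :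
    ∑ j ∈ Finset.range k, (inner ℝ (a j) (x k - w) / inner ℝ (a j) (x j - x k)) ^ 2
      ≤ localDist (P k) (x k) w ^ 2 := by
  have h := sum_cuts hP (fun r β => (inner ℝ r (x k - w) / (β - inner ℝ r (x k))) ^ 2) k
  have h2 : localDist (P k) (x k) w ^ 2
      = ∑ i, (inner ℝ ((P k).row i) (x k - w) / ((P k).rhs i - inner ℝ ((P k).row i) (x k))) ^ 2 := by
    rw [localDist_sq]
    exact Finset.sum_congr rfl fun i _ => by rw [(P k).slack_sub]; rfl
  rw [h2, h]
  simp only [inner_sub_right]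
  have : 0 ≤ ∑ i, ((inner ℝ ((P 0).row i) (x k) - inner ℝ ((P 0).row i) w) /
      ((P 0).rhs i - inner ℝ ((P 0).row i) (x k))) ^ 2 := Finset.sum_nonneg fun _ _ => sq_nonneg _
  linarith

theorem slack_pos_of_le (hP : ∀ k, P (k + 1) = (P k).addRow (a k) (inner ℝ (a k) (x k)))
    {k : ℕ} {w : E n} (hw : ∀ i, 0 < (P k).slack w i) :
    (∀ i, 0 < (P 0).slack w i) ∧ ∀ j < k, 0 < inner ℝ (a j) (x j - w) := by
  induction k with
  | zero => exact ⟨hw, by simp⟩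
  | succ k ih =>
    rw [hP k] at hw
    obtain ⟨h1, h2⟩ := ((P k).forall_slack_addRow _ _ w (0 < ·)).1 hw
    obtain ⟨h3, h4⟩ := ih h1
    refine ⟨h3, fun j hj => ?_⟩
    rcases Nat.lt_succ_iff_lt_or_eq.1 hj with hj | rfl
    · exact h4 j hj
    · rwa [inner_sub_right]

theorem feasible_subset_zero (hP : ∀ k, P (k + 1) = (P k).addRow (a k) (inner ℝ (a k) (x k)))
    (k : ℕ) : (P k).feasible ⊆ (P 0).feasible := by
  induction k with
  | zero => exact subset_rfl
  | succ k ih =>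
    rw [hP k]
    exact fun y hy => ih (((P k).mem_feasible_addRow _ _ y).1 hy).1

/-- Late cuts are well represented by the earlier ones. -/
theorem eventually_cut_le {η D M κ : ℝ}
    (hP : ∀ k, P (k + 1) = (P k).addRow (a k) (inner ℝ (a k) (x k)))
    (hx : ∀ k, IsApproxCenter η (P k) (x k)) (hD : 0 < D) (hM : 0 < M)
    (hbd : ∀ y ∈ (P 0).feasible, ∀ z ∈ (P 0).feasible, ‖y - z‖ ≤ D) (ha : ∀ k, ‖a k‖ ≤ M)
    (hκ : 0 < κ) :
    ∀ᶠ k in atTop, ∀ w, inner ℝ (a k) (x k - w) ≤ κ * localDist (P k) (x k) w := by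
  -- Averaging over `N` close predecessors bounds `⟪a k, u⟫²` by `2(MD)²ρ²/N + κ²ρ²/2`, and this `N`
  -- makes the first term at most `κ²ρ²/2`. The closeness `κ/(2D)` produces the second term, because
  -- `‖u‖ ≤ Dρ`.
  obtain ⟨N, hN⟩ := exists_nat_gt (4 * (M * D) ^ 2 / κ ^ 2)
  have hN0 : (0 : ℝ) < N := lt_of_le_of_lt (by positivity) hN
  rw [div_lt_iff₀ (by positivity)] at hN
  filter_upwards [eventually_exists_close a ha N (θ := κ / (2 * D)) (by positivity)] with k hk w
  obtain ⟨I, hI, hIN, hIa⟩ := hk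
  set ρ := localDist (P k) (x k) w with hρ
  set u := x k - w with hu
  have hρ0 : 0 ≤ ρ := localDist_nonneg _ _ _
  refine abs_le_of_sq_le_sq' ?_ (by positivity) |>.2
  have hfeas : ∀ j, x j ∈ (P 0).feasible := fun j => feasible_subset_zero hP j (hx j).mem_feasible
  have hun : ‖u‖ ≤ D * ρ := by
    rw [hu, norm_sub_rev]
    exact norm_sub_le_mul_localDist hD
      (fun y hy z hz => hbd y (feasible_subset_zero hP k hy) z (feasible_subset_zero hP k hz))
      (hx k).1
  have hterm : ∀ i ∈ I, inner ℝ (a k) u ^ 2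
      ≤ 2 * (M * D) ^ 2 * (inner ℝ (a i) u / inner ℝ (a i) (x i - x k)) ^ 2
        + κ ^ 2 * ρ ^ 2 / 2 := by
    intro i hi
    have hs : 0 < inner ℝ (a i) (x i - x k) :=
      (slack_pos_of_le hP (hx k).1).2 i (Finset.mem_range.1 (hI hi))
    have hs2 : inner ℝ (a i) (x i - x k) ≤ M * D :=
      (real_inner_le_norm _ _).trans
        (mul_le_mul (ha i) (hbd _ (hfeas i) _ (hfeas k)) (norm_nonneg _) hM.le)
    have h1 : inner ℝ (a i) u ^ 2
        ≤ (M * D) ^ 2 * (inner ℝ (a i) u / inner ℝ (a i) (x i - x k)) ^ 2 := by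
      have e : inner ℝ (a i) u ^ 2 = inner ℝ (a i) (x i - x k) ^ 2 *
          (inner ℝ (a i) u / inner ℝ (a i) (x i - x k)) ^ 2 := by
        field_simp
      rw [e]
      gcongr ?_ * _
      · exact pow_le_pow_left₀ hs.le hs2 2
    have h2 : inner ℝ (a k - a i) u ^ 2 ≤ κ ^ 2 * ρ ^ 2 / 4 := by
      have h3 : |inner ℝ (a k - a i) u| ≤ κ / (2 * D) * (D * ρ) :=
        (abs_real_inner_le_norm _ _).trans
          (mul_le_mul (hIa i hi) hun (norm_nonneg _) (by positivity))
      have h4 : κ / (2 * D) * (D * ρ) = κ * ρ / 2 := by field_simp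
      rw [h4] at h3
      have := sq_le_sq' (abs_le.1 h3).1 (abs_le.1 h3).2
      linarith [this, show (κ * ρ / 2) ^ 2 = κ ^ 2 * ρ ^ 2 / 4 by ring]
    have h5 : inner ℝ (a k) u = inner ℝ (a i) u + inner ℝ (a k - a i) u := by
      rw [inner_sub_left]; ring
    rw [h5]
    linarith [sq_nonneg (inner ℝ (a i) u - inner ℝ (a k - a i) u),
      add_sq (inner ℝ (a i) u) (inner ℝ (a k - a i) u),
      sub_sq (inner ℝ (a i) u) (inner ℝ (a k - a i) u)]
  have hsum := Finset.sum_le_sum hterm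
  rw [Finset.sum_add_distrib, ← Finset.mul_sum, Finset.sum_const, Finset.sum_const, hIN,
    nsmul_eq_mul, nsmul_eq_mul] at hsum
  have hle : ∑ i ∈ I, (inner ℝ (a i) u / inner ℝ (a i) (x i - x k)) ^ 2 ≤ ρ ^ 2 :=
    (Finset.sum_le_sum_of_subset_of_nonneg hI fun _ _ _ => sq_nonneg _).trans
      (sum_cuts_le_localDist_sq hP k w)
  have h6 : 2 * (M * D) ^ 2 * ∑ i ∈ I, (inner ℝ (a i) u / inner ℝ (a i) (x i - x k)) ^ 2
      ≤ 2 * (M * D) ^ 2 * ρ ^ 2 := by gcongr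
  have h7 : 2 * (M * D) ^ 2 * ρ ^ 2 ≤ (N * κ ^ 2 / 2) * ρ ^ 2 :=
    mul_le_mul_of_nonneg_right (by linarith) (sq_nonneg _)
  rw [mul_pow]
  refine le_of_mul_le_mul_left ?_ hN0
  linarith

/-- An infinite sequence of central cuts cannot keep a positive distance from a point. -/
theorem exists_cut_lt {η D M δ : ℝ} (hη0 : 0 ≤ η) (hη1 : η < 1)
    (hP : ∀ k, P (k + 1) = (P k).addRow (a k) (inner ℝ (a k) (x k)))
    (hx : ∀ k, IsApproxCenter η (P k) (x k)) (hD : 0 < D) (hM : 0 < M)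
    (hbd : ∀ y ∈ (P 0).feasible, ∀ z ∈ (P 0).feasible, ‖y - z‖ ≤ D) (ha : ∀ k, ‖a k‖ ≤ M)
    (hδ : 0 < δ) {w : E n} (hw : ∀ i, 0 < (P 0).slack w i) :
    ∃ k, inner ℝ (a k) (x k - w) < δ := by
  by_contra! hcon
  have hη : 0 < 1 - η := by linarith
  -- The maximum over `ρ ≥ 0` of `3√ρ - (1 - η)ρ`: one `√ρ` comes from the potential bound and two
  -- from `log ρ ≤ 2√ρ`.
  set B : ℝ := 9 / (4 * (1 - η)) with hB
  have hwk : ∀ k, ∀ i, 0 < (P k).slack w i := by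
    intro k
    induction k with
    | zero => exact hw
    | succ k ih =>
      rw [hP k]
      refine ((P k).forall_slack_addRow _ _ w (0 < ·)).2 ⟨ih, ?_⟩
      rw [← inner_sub_right]
      exact hδ.trans_le (hcon k)
  -- This `κ` satisfies `log κ + B = log δ - 1`, one unit less than what `w` is guaranteed per cut.
  obtain ⟨k₀, hk₀⟩ := eventually_atTop.1 (eventually_cut_le hP hx hD hM hbd ha
    (Real.exp_pos (Real.log δ - 1 - B)))
  have hstep : ∀ k ≥ k₀, ∀ v, (∀ i, 0 < (P (k + 1)).slack v i) →
      potential (P (k + 1)) v ≤ potential (P k) (x k) + (Real.log δ - 1) := by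
    intro k hk v hv
    rw [hP k] at hv
    obtain ⟨hv1, hv2⟩ := ((P k).forall_slack_addRow _ _ v (0 < ·)).1 hv
    rw [← inner_sub_right] at hv2
    set ρ := localDist (P k) (x k) v with hρ
    have h1 := hk₀ k hk v
    have hρ0 : 0 < ρ := by
      by_contra h
      have : Real.exp (Real.log δ - 1 - B) * ρ ≤ 0 :=
        mul_nonpos_of_nonneg_of_nonpos (Real.exp_pos _).le (not_lt.1 h)
      linarith
    have h2 := Real.log_le_log hv2 h1
    rw [Real.log_mul (Real.exp_pos _).ne' hρ0.ne', Real.log_exp] at h2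
    have h3 : Real.log ρ ≤ 2 * √ρ := by
      have := Real.log_le_sub_one_of_pos (Real.sqrt_pos.2 hρ0)
      rw [Real.log_sqrt hρ0.le] at this
      linarith
    have h4 : 3 * √ρ - (1 - η) * ρ ≤ B := by
      rw [hB, le_div_iff₀ (by positivity)]
      have := Real.mul_self_sqrt hρ0.le
      have h5 : (1 - η) * ρ = (1 - η) * (√ρ * √ρ) := by rw [this]
      rw [h5]
      nlinarith [sq_nonneg (2 * (1 - η) * √ρ - 3)]
    have h5 := (hx k).potential_le hη0 hv1
    rw [potential_succ hP]
    linarith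
  have hup : ∀ j, potential (P (k₀ + j)) (x (k₀ + j))
      ≤ potential (P k₀) (x k₀) + j * (Real.log δ - 1) := by
    intro j
    induction j with
    | zero => simp
    | succ j ih =>
      have := hstep (k₀ + j) (Nat.le_add_right _ _) (x (k₀ + j + 1)) (hx (k₀ + j + 1)).1
      rw [← add_assoc]
      push_cast
      linarith
  have hlow : ∀ j, potential (P k₀) w + j * Real.log δ ≤ potential (P (k₀ + j)) w := by
    intro j
    induction j with
    | zero => simp
    | succ j ih =>
      rw [← add_assoc, potential_succ hP]
      have := Real.log_le_log hδ (hcon (k₀ + j))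
      push_cast
      linarith
  obtain ⟨j, hj⟩ := exists_nat_gt (potential (P k₀) (x k₀) - potential (P k₀) w)
  -- The `j + 1` cuts after `k₀` put `w` ahead by `j + 1` units, more than the initial deficit.
  have h1 := hlow (j + 1)
  have h2 := hstep (k₀ + j) (Nat.le_add_right _ _) w (hwk _)
  have h3 := hup j
  rw [← add_assoc] at h1
  push_cast at h1
  linarith

end Cuts

end ACCPM

namespace ACCPM

/-! ### The gap function -/

theorem continuous_inner_sub {n : ℕ} (v x : E n) : Continuous fun y : E n => inner ℝ v (x - y) := by
  fun_prop

theorem inner_le_gap {n : ℕ} {F : E n → E n} {K : Set (E n)} (hK : IsCompact K) (x : E n) {y : E n}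
    (hy : y ∈ K) : inner ℝ (F x) (x - y) ≤ gap F K x :=
  le_csSup (hK.image (continuous_inner_sub (F x) x)).bddAbove ⟨y, hy, rfl⟩

theorem exists_inner_eq_gap {n : ℕ} {F : E n → E n} {K : Set (E n)} (hK : IsCompact K)
    (hne : K.Nonempty) (x : E n) : ∃ y ∈ K, inner ℝ (F x) (x - y) = gap F K x :=
  (hK.image (continuous_inner_sub (F x) x)).sSup_mem (hne.image _)

theorem mem_solutions_of_gap_eq_zero {n : ℕ} {F : E n → E n} {K : Set (E n)} (hK : IsCompact K)
    {x : E n} (hx : x ∈ K) (h : gap F K x = 0) : x ∈ solutions F K := by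
  refine ⟨hx, fun y hy => ?_⟩
  have := h ▸ inner_le_gap (F := F) hK x hy
  rw [← neg_sub, inner_neg_right] at this
  linarith

/-- Contrapositively, a point that fails the stopping test produces a cut with nonzero normal. -/
theorem gap_eq_zero_of_eq_zero {n : ℕ} {F : E n → E n} {K : Set (E n)} (hne : K.Nonempty) {x : E n}
    (h : F x = 0) : gap F K x = 0 := by
  simp [gap, h, hne]

/-! ### Invariants of the algorithm -/

section Approximation

variable {n : ℕ} {X : Set (E n)} {C : ℕ → LinSystem n}

theorem InnerApproximation.subset (hC : InnerApproximation X C) {j : ℕ} (hj : 1 ≤ j) :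
    (C j).feasible ⊆ X := by
  rw [← hC.closure_eq]
  exact (Set.subset_iUnion₂ (s := fun j (_ : 1 ≤ j) => (C j).feasible) j hj).trans subset_closure

theorem InnerApproximation.subset_of_le (hC : InnerApproximation X C) {i j : ℕ} (hi : 1 ≤ i)
    (hij : i ≤ j) : (C i).feasible ⊆ (C j).feasible := by
  induction j, hij using Nat.le_induction with
  | base => exact subset_rfl
  | succ j hj ih => exact ih.trans (hC.mono j (hi.trans hj))

theorem InnerApproximation.isCompact (hC : InnerApproximation X C) (hX : IsCompact X) {j : ℕ}
    (hj : 1 ≤ j) : IsCompact (C j).feasible :=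
  hX.of_isClosed_subset (C j).isClosed_feasible (hC.subset hj)

theorem InnerApproximation.nonempty (hC : InnerApproximation X C) {j : ℕ} (hj : 1 ≤ j) :
    (C j).feasible.Nonempty :=
  (hC.fullDim j hj).imp fun _ hx i => (hx i).le

/-- Limits along stages of approximate solutions of `VI(F, C_j)` solve `VI(F, X)`. -/
theorem InnerApproximation.mem_solutions_of_tendsto (hC : InnerApproximation X C)
    (hX : IsCompact X) {F : E n → E n} (hFc : ContinuousOn F X) {j : ℕ → ℕ}
    (hj : Tendsto j atTop atTop) {x : ℕ → E n} (hx : ∀ q, x q ∈ X)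
    (hgap : ∀ q, gap F (C (j q)).feasible (x q) < 1 / 2 ^ j q) {xs : E n} (hxs : xs ∈ X)
    (hlim : Tendsto x atTop (𝓝 xs)) : xs ∈ solutions F X := by
  have hF : Tendsto (fun q => F (x q)) atTop (𝓝 (F xs)) :=
    (hFc xs hxs).tendsto.comp (tendsto_nhdsWithin_iff.2 ⟨hlim, Eventually.of_forall hx⟩)
  have hcl : IsClosed {y : E n | 0 ≤ inner ℝ (F xs) (y - xs)} :=
    isClosed_le continuous_const (by fun_prop)
  refine ⟨hxs, ?_⟩
  suffices h : X ⊆ {y : E n | 0 ≤ inner ℝ (F xs) (y - xs)} from fun y hy => h hy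
  conv_lhs => rw [← hC.closure_eq]
  refine closure_minimal (Set.iUnion₂_subset fun i hi y hy => ?_) hcl
  have h2 : Tendsto (fun q => (1 : ℝ) / 2 ^ j q) atTop (𝓝 0) := by
    have := (tendsto_pow_atTop_nhds_zero_of_lt_one (r := (1 / 2 : ℝ)) (by norm_num)
      (by norm_num)).comp hj
    simpa [Function.comp_def] using this
  -- A fixed `y ∈ C_i` lies in all later polytopes, so their gaps eventually bound the inner
  -- product.
  have h3 : inner ℝ (F xs) (xs - y) ≤ 0 := by
    refine le_of_tendsto_of_tendsto (hF.inner (hlim.sub_const y)) h2 ?_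
    filter_upwards [hj.eventually_ge_atTop i] with q hq
    exact (inner_le_gap (hC.isCompact hX (hi.trans hq)) (x q)
      (hC.subset_of_le hi hq hy)).trans (hgap q).le
  change 0 ≤ inner ℝ (F xs) (y - xs)
  rw [← neg_sub, inner_neg_right]
  linarith

variable {F : E n → E n} {x : ℕ → E n}

theorem stateAt_succ_of_lt {N : ℕ}
    (h : gap F (C (stateAt F C x N).stage).feasible (x N) < 1 / 2 ^ (stateAt F C x N).stage) :
    stateAt F C x (N + 1) = State.start C ((stateAt F C x N).stage + 1) := if_pos h

theorem stateAt_succ_of_not_lt {N : ℕ}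
    (h : ¬gap F (C (stateAt F C x N).stage).feasible (x N) < 1 / 2 ^ (stateAt F C x N).stage) :
    stateAt F C x (N + 1) =
      { stage := (stateAt F C x N).stage
        iter := (stateAt F C x N).iter + 1
        sys := (stateAt F C x N).sys.addRow (F (x N)) (inner ℝ (F (x N)) (x N)) } := if_neg h

theorem stage_le_succ (F : E n → E n) (C : ℕ → LinSystem n) (x : ℕ → E n) (N : ℕ) :
    (stateAt F C x N).stage ≤ (stateAt F C x (N + 1)).stage := by
  by_cases h : gap F (C (stateAt F C x N).stage).feasible (x N) < 1 / 2 ^ (stateAt F C x N).stage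
  · rw [stateAt_succ_of_lt h]; exact Nat.le_succ _
  · rw [stateAt_succ_of_not_lt h]

theorem monotone_stage (F : E n → E n) (C : ℕ → LinSystem n) (x : ℕ → E n) :
    Monotone fun N => (stateAt F C x N).stage :=
  monotone_nat_of_le_succ (stage_le_succ F C x)

theorem one_le_stage (F : E n → E n) (C : ℕ → LinSystem n) (x : ℕ → E n) (N : ℕ) :
    1 ≤ (stateAt F C x N).stage :=
  monotone_stage F C x (Nat.zero_le N)

theorem feasible_stateAt_subset (F : E n → E n) (C : ℕ → LinSystem n) (x : ℕ → E n) (N : ℕ) :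
    (stateAt F C x N).sys.feasible ⊆ (C (stateAt F C x N).stage).feasible := by
  induction N with
  | zero => exact subset_rfl
  | succ N ih =>
    by_cases h : gap F (C (stateAt F C x N).stage).feasible (x N) <
        1 / 2 ^ (stateAt F C x N).stage
    · rw [stateAt_succ_of_lt h]; exact subset_rfl
    · rw [stateAt_succ_of_not_lt h]
      exact fun y hy => ih ((LinSystem.mem_feasible_addRow _ _ _ y).1 hy).1

theorem InnerApproximation.feasible_stateAt_subset (hC : InnerApproximation X C) (F : E n → E n)
    (x : ℕ → E n) (N : ℕ) : (stateAt F C x N).sys.feasible ⊆ X :=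
  (ACCPM.feasible_stateAt_subset F C x N).trans (hC.subset (one_le_stage F C x N))

/-- Cuts never remove a solution of the Minty inequality on the current polytope. -/
theorem mem_feasible_stateAt_of_minty {N : ℕ}
    (hx : ∀ i < N, x i ∈ (stateAt F C x i).sys.feasible) {y : E n}
    (hy : y ∈ (C (stateAt F C x N).stage).feasible)
    (hM : ∀ z ∈ (C (stateAt F C x N).stage).feasible, 0 ≤ inner ℝ (F z) (z - y)) :
    y ∈ (stateAt F C x N).sys.feasible := by
  induction N with
  | zero => exact hy
  | succ N ih =>
    by_cases h : gap F (C (stateAt F C x N).stage).feasible (x N) <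
        1 / 2 ^ (stateAt F C x N).stage
    · rw [stateAt_succ_of_lt h] at hy ⊢; exact hy
    · rw [stateAt_succ_of_not_lt h] at hy hM ⊢
      refine (LinSystem.mem_feasible_addRow _ _ _ y).2
        ⟨ih (fun i hi => hx i (hi.trans N.lt_succ_self)) hy hM, ?_⟩
      have := hM (x N) (feasible_stateAt_subset F C x N (hx N N.lt_succ_self))
      rw [inner_sub_right] at this
      linarith

/-- A central cut leaves strictly feasible points. -/
theorem LinSystem.exists_slack_pos_addRow {P : LinSystem n} {a p : E n} (ha : a ≠ 0)
    (hp : ∀ i, 0 < P.slack p i) : ∃ y, ∀ i, 0 < (P.addRow a (inner ℝ a p)).slack y i := by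
  have hev : ∀ᶠ t : ℝ in 𝓝 0, ∀ i, 0 < P.slack (p - t • a) i := by
    refine eventually_all.2 fun i => ?_
    have hc : Continuous fun t : ℝ => P.slack (p - t • a) i := by fun_prop
    exact hc.continuousAt.eventually (eventually_gt_nhds (by simpa using hp i))
  obtain ⟨t, ht, ht0⟩ := ((hev.filter_mono nhdsWithin_le_nhds).and
    (self_mem_nhdsWithin (s := Set.Ioi (0 : ℝ)))).exists
  refine ⟨p - t • a, (P.forall_slack_addRow _ _ _ (0 < ·)).2 ⟨ht, ?_⟩⟩
  rw [inner_sub_right, inner_smul_right, sub_sub_cancel]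
  exact mul_pos ht0 (real_inner_self_pos.2 ha)

theorem Reaches.exists_slack_pos {η : ℝ} (hC : InnerApproximation X C) {N : ℕ}
    (h : Reaches F X C η x N) : ∃ y, ∀ i, 0 < (stateAt F C x N).sys.slack y i := by
  cases N with
  | zero => exact hC.fullDim 1 le_rfl
  | succ N =>
    by_cases hg : gap F (C (stateAt F C x N).stage).feasible (x N) <
        1 / 2 ^ (stateAt F C x N).stage
    · rw [stateAt_succ_of_lt hg]; exact hC.fullDim _ (Nat.le_add_left _ _)
    · rw [stateAt_succ_of_not_lt hg]
      obtain ⟨hc, hne⟩ := h N N.lt_succ_self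
      exact LinSystem.exists_slack_pos_addRow
        (fun h0 => hne (gap_eq_zero_of_eq_zero ((hC.nonempty le_rfl).mono (hC.subset le_rfl)) h0))
        hc.1

/-- A stage of the algorithm cannot go on forever. -/
theorem exists_gap_lt {η : ℝ} (hX : IsCompact X) (hFc : ContinuousOn F X)
    (hF : PseudomonotonePlus F X) (hC : InnerApproximation X C) (hη0 : 0 ≤ η) (hη1 : η < 1)
    (hx : ∀ N, IsApproxCenter η (stateAt F C x N).sys (x N)) (N₀ : ℕ) :
    ∃ N ≥ N₀, gap F (C (stateAt F C x N).stage).feasible (x N) <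
      1 / 2 ^ (stateAt F C x N).stage := by
  by_contra! hcon
  set J := (stateAt F C x N₀).stage with hJdef
  have hJ1 : 1 ≤ J := one_le_stage F C x N₀
  have hstage : ∀ k, (stateAt F C x (N₀ + k)).stage = J := by
    intro k
    induction k with
    | zero => rfl
    | succ k ih =>
      rw [← add_assoc, stateAt_succ_of_not_lt (hcon _ (Nat.le_add_right _ _)).not_gt]
      exact ih
  set K := (C J).feasible with hKdef
  have hK : IsCompact K := hC.isCompact hX hJ1
  have hKX : K ⊆ X := hC.subset hJ1
  have hKv : Convex ℝ K := (C J).convex_feasible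
  have hKne : K.Nonempty := hC.nonempty hJ1
  have hFK : ContinuousOn F K := hFc.mono hKX
  have hxK : ∀ k, x (N₀ + k) ∈ K := fun k => by
    have := feasible_stateAt_subset F C x (N₀ + k) (hx (N₀ + k)).mem_feasible
    rwa [hstage k] at this
  have hgap : ∀ k, 1 / 2 ^ J ≤ gap F K (x (N₀ + k)) := fun k => by
    have := hcon (N₀ + k) (Nat.le_add_right _ _)
    rwa [hstage k] at this
  obtain ⟨y, hyK, hyM⟩ := Pseudomonotone.exists_minty (F := F)
    (fun u hu v hv => hF.1 u (hKX hu) v (hKX hv)) hK hKv hKne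
  have hysol := mem_solutions_of_minty hFK hKv hyK hyM
  have hyfeas : y ∈ (stateAt F C x N₀).sys.feasible :=
    mem_feasible_stateAt_of_minty (fun i _ => (hx i).mem_feasible) hyK hyM
  obtain ⟨D, hD⟩ := Metric.isBounded_iff.1 hK.isBounded
  obtain ⟨M, hM⟩ := hK.exists_bound_of_continuousOn hFK
  -- `y` may lie on the boundary of the current polytope, so it is moved slightly towards the
  -- strictly feasible `x N₀`. The system at `N₀` serves as the initial one, even in mid-stage.
  have hcut : ∀ q : ℕ, ∃ k, inner ℝ (F (x (N₀ + k)))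
      (x (N₀ + k) - (y + (1 / ((q : ℝ) + 1)) • (x N₀ - y))) < 1 / ((q : ℝ) + 1) := by
    intro q
    have hq0 : 0 < 1 / ((q : ℝ) + 1) := by positivity
    have hq1 : 1 / ((q : ℝ) + 1) ≤ 1 := by
      rw [div_le_one (by positivity)]; linarith [(Nat.cast_nonneg q : (0 : ℝ) ≤ q)]
    refine exists_cut_lt (P := fun k => (stateAt F C x (N₀ + k)).sys) (a := fun k => F (x (N₀ + k)))
      (x := fun k => x (N₀ + k)) (D := max D 1) (M := max M 1) hη0 hη1 (fun k => ?_)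
      (fun k => hx (N₀ + k)) (by positivity) (by positivity) (fun u hu v hv => ?_)
      (fun k => (hM _ (hxK k)).trans (le_max_left _ _)) hq0 fun i => ?_
    · change (stateAt F C x (N₀ + k + 1)).sys = _
      rw [stateAt_succ_of_not_lt (hcon _ (Nat.le_add_right _ _)).not_gt]
    · rw [← dist_eq_norm]
      exact (hD (feasible_stateAt_subset F C x N₀ hu)
        (feasible_stateAt_subset F C x N₀ hv)).trans (le_max_left _ _)
    · rw [LinSystem.slack_add_smul]
      have h1 := (hx N₀).1 i
      have h2 := hyfeas i
      change 0 < (stateAt F C x N₀).sys.slack y i + _ * ((stateAt F C x N₀).sys.slack (x N₀) i -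
        (stateAt F C x N₀).sys.slack y i)
      have h3 := mul_pos hq0 h1
      have h4 := mul_nonneg (sub_nonneg.2 hq1) h2
      linarith
  choose k hk using hcut
  choose p hpK hp using fun q => exists_inner_eq_gap (F := F) hK hKne (x (N₀ + k q))
  -- The indices `k q` need not increase; compactness alone yields a joint limit of the iterates and
  -- their gap maximizers.
  obtain ⟨⟨xb, pb⟩, ⟨hxb, hpb⟩, ψ, hψ, hlim⟩ := (hK.prod hK).tendsto_subseq
    (x := fun q => (x (N₀ + k q), p q)) fun q => ⟨hxK (k q), hpK q⟩
  have hlx : Tendsto (fun q => x (N₀ + k (ψ q))) atTop (𝓝 xb) :=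
    (continuous_fst.tendsto _).comp hlim
  have hlp : Tendsto (fun q => p (ψ q)) atTop (𝓝 pb) := (continuous_snd.tendsto _).comp hlim
  have hlF : Tendsto (fun q => F (x (N₀ + k (ψ q)))) atTop (𝓝 (F xb)) :=
    (hFK xb hxb).tendsto.comp
      (tendsto_nhdsWithin_iff.2 ⟨hlx, Eventually.of_forall fun q => hxK _⟩)
  have hl0 : Tendsto (fun q : ℕ => 1 / ((ψ q : ℝ) + 1)) atTop (𝓝 0) :=
    tendsto_one_div_add_atTop_nhds_zero_nat.comp hψ.tendsto_atTop
  have h1 : inner ℝ (F xb) (xb - y) ≤ 0 := by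
    have hl1 : Tendsto (fun q => inner ℝ (F (x (N₀ + k (ψ q))))
        (x (N₀ + k (ψ q)) - (y + (1 / ((ψ q : ℝ) + 1)) • (x N₀ - y)))) atTop
        (𝓝 (inner ℝ (F xb) (xb - (y + (0 : ℝ) • (x N₀ - y))))) :=
      hlF.inner (hlx.sub (tendsto_const_nhds.add (hl0.smul_const _)))
    rw [zero_smul, add_zero] at hl1
    exact le_of_tendsto_of_tendsto' hl1 hl0 fun q => (hk (ψ q)).le
  have h2 : 1 / 2 ^ J ≤ inner ℝ (F xb) (xb - pb) := by
    refine ge_of_tendsto' (hlF.inner (hlx.sub hlp)) fun q => ?_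
    rw [hp (ψ q)]
    exact hgap _
  have h3 : inner ℝ (F xb) (xb - y) = 0 := le_antisymm h1 (hyM xb hxb)
  have h4 : F y = F xb := hF.2 y (hKX hyK) xb (hKX hxb) (hysol.2 xb hxb) h3
  have h5 := hysol.2 pb hpb
  rw [h4] at h5
  have h6 : inner ℝ (F xb) (xb - pb) = inner ℝ (F xb) (xb - y) - inner ℝ (F xb) (pb - y) := by
    simp only [inner_sub_right]; ring
  have h7 : (0 : ℝ) < 1 / 2 ^ J := by positivity
  linarith

end Approximation

end ACCPM

theorem theorem2 {n : ℕ} (X : Set (ACCPM.E n)) (hXc : IsCompact X) (hXv : Convex ℝ X)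
    (hXi : (interior X).Nonempty)
    (F : ACCPM.E n → ACCPM.E n) (hFc : ContinuousOn F X) (hF : ACCPM.PseudomonotonePlus F X)
    (C : ℕ → ACCPM.LinSystem n) (hC : ACCPM.InnerApproximation X C)
    (η : ℝ) (hη0 : 0 ≤ η) (hη1 : η < 1) :
    -- every iteration that is reached can be carried out
    (∀ (x : ℕ → ACCPM.E n) (N : ℕ), ACCPM.Reaches F X C η x N →
      ∃ p, ACCPM.IsApproxCenter η (ACCPM.stateAt F C x N).sys p) ∧
    -- every execution stops at a solution, or is infinite and subconverges to a solution
    (∀ x : ℕ → ACCPM.E n, ACCPM.IsExecution F X C η x →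
      (∃ N, (∀ i < N, ACCPM.gap F X (x i) ≠ 0) ∧ ACCPM.gap F X (x N) = 0 ∧
        x N ∈ ACCPM.solutions F X) ∨
      ((∀ i, ACCPM.gap F X (x i) ≠ 0) ∧
        ∃ xs ∈ ACCPM.solutions F X, ∃ φ : ℕ → ℕ, StrictMono φ ∧
          Tendsto (fun q => x (φ q)) atTop (𝓝 xs))) := by
  refine ⟨fun x N h => ?_, fun x hx => ?_⟩
  · exact ACCPM.exists_isApproxCenter hη0 _
      (hXc.of_isClosed_subset (ACCPM.LinSystem.isClosed_feasible _)
        (hC.feasible_stateAt_subset F x N)) (h.exists_slack_pos hC)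
  by_cases hzero : ∃ N, ACCPM.gap F X (x N) = 0
  · classical
    left
    -- Only the first zero of the gap is where the execution stops; later values of `x` are
    -- arbitrary.
    have hmin : ∀ i < Nat.find hzero, ACCPM.gap F X (x i) ≠ 0 := fun i hi => Nat.find_min hzero hi
    have hmem := hC.feasible_stateAt_subset F x _ (hx _ hmin).mem_feasible
    exact ⟨Nat.find hzero, hmin, Nat.find_spec hzero,
      ACCPM.mem_solutions_of_gap_eq_zero hXc hmem (Nat.find_spec hzero)⟩
  · right
    push Not at hzero
    refine ⟨hzero, ?_⟩
    have hcen : ∀ N, ACCPM.IsApproxCenter η (ACCPM.stateAt F C x N).sys (x N) :=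
      fun N => hx N fun i _ => hzero i
    have hxX : ∀ N, x N ∈ X := fun N => hC.feasible_stateAt_subset F x N (hcen N).mem_feasible
    obtain ⟨φ, hφ, hφg⟩ := extraction_of_frequently_atTop
      (frequently_atTop.2 (ACCPM.exists_gap_lt hXc hFc hF hC hη0 hη1 hcen))
    -- Each selected iteration closes its stage, so the next one belongs to a later stage.
    have hsm : StrictMono fun q => (ACCPM.stateAt F C x (φ q)).stage := by
      refine strictMono_nat_of_lt_succ fun q => ?_
      have h := ACCPM.monotone_stage F C x (Nat.succ_le_of_lt (hφ q.lt_succ_self))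
      simp only [Nat.succ_eq_add_one, ACCPM.stateAt_succ_of_lt (hφg q)] at h
      exact Nat.lt_of_succ_le h
    obtain ⟨xs, hxs, ψ, hψ, hlim⟩ := hXc.tendsto_subseq fun q => hxX (φ q)
    exact ⟨xs, hC.mem_solutions_of_tendsto hXc hFc (hsm.comp hψ).tendsto_atTop
      (fun q => hxX (φ (ψ q))) (fun q => hφg (ψ q)) hxs hlim, φ ∘ ψ, hφ.comp hψ, hlim⟩
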